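/- For $x\in\mathbb R$ write $e(x)=e^{2\pi i x}$. For an integer $q\ge 1$ and $n\in\mathbb Z$ let $c_q(n)=\sum_{u \bmod q,\ \gcd(u,q)=1} e(un/q)$ be the classical Ramanujan sum. For a commutative ring $R$ let $U(R)$ be the group of upper triangular $3\times 3$ matrices over $R$ with $1$'s on the diagonal, and for $n=(n_1,n_2)\in\mathbb Z^2$ and $u\in U(\mathbb R)$ put $\psi_n(u)=e(n_1u_{12}+n_2u_{23})$. Let $$w_0=\begin{pmatrix}0&0&1\\0&-1&0\\1&0&0\end{pmatrix},\qquad t(c_1,c_2)=\mathrm{diag}\left(c_1,\tfrac{c_2}{c_1},\tfrac1{c_2}\right),$$ and for nonzero integers $c_1,c_2$ let $$\Omega_{w_0}(c_1,c_2)=\{A\in SL_3(\mathbb Z): A=u_L\,w_0\,t(c_1,c_2)\,u_R \text{ for some } u_L,u_R\in U(\mathbb R)\}.$$ The long word $SL_3$ Kloosterman sum is $$S_{w_0}(m,n;(c_1,c_2))=\sum_{A\in U(\mathbb Z)\backslash\Omega_{w_0}(c_1,c_2)/U(\mathbb Z),\ A=u_Lw_0t(c_1,c_2)u_R}\psi_m(u_L)\,\psi_n(u_R)\qquad(m,n\in\mathbb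 Z^2),$$ where the summand depends only on the double coset of $A$. **Lemma.** Let $c_1,c_2$ be positive integers and $n_1,n_2\in\mathbb Z$. Then the set of double cosets $U(\mathbb Z)\backslash\Omega_{w_0}(c_1,c_2)/U(\mathbb Z)$ is finite, and the Ramanujan sum $R_{c_1,c_2}(n_1,n_2)=S_{w_0}((0,0),(n_1,n_2);(c_1,c_2))$ satisfies $$R_{c_1,c_2}(n_1,n_2)=\sum_{\substack{f\mid\gcd(c_1,c_2)\\ f\mid n_2c_1/f}} f\;c_{c_1/f}(n_1)\;c_f(n_2)\;c_{c_2/f}\!\left(\frac{c_1n_2}{f^2}\right),$$ where $f$ runs over positive divisors. -/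

import Mathlib

open scoped MatrixGroups

/-- The group `U(R)` of upper triangular `3 × 3` matrices over `R` with `1`s on the diagonal, as a
subgroup of `SL(3, R)`. -/
def unipotentSubgroup (R : Type*) [CommRing R] : Subgroup SL(3, R) where
  carrier := {u | (∀ i, u i i = 1) ∧ ∀ i j, j < i → u i j = 0}
  one_mem' := by
    refine ⟨fun i => by simp, fun i j h => ?_⟩
    simp [h.ne']
  mul_mem' := by
    rintro a b ⟨ha, ha'⟩ ⟨hb, hb'⟩
    refine ⟨fun i => ?_, fun i j h => ?_⟩
    · fin_cases i <;>
        simp [Matrix.SpecialLinearGroup.coe_mul, Matrix.mul_apply, Fin.sum_univ_three, ha, hb, ha',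
          hb']
    · fin_cases i <;> fin_cases j <;>
        simp [Matrix.SpecialLinearGroup.coe_mul, Matrix.mul_apply, Fin.sum_univ_three, ha, hb, ha',
          hb'] at h ⊢
  inv_mem' := by
    rintro a ⟨ha, ha'⟩
    have h10 := ha' 1 0 (by decide)
    have h20 := ha' 2 0 (by decide)
    have h21 := ha' 2 1 (by decide)
    refine ⟨fun i => ?_, fun i j h => ?_⟩
    · rw [Matrix.SpecialLinearGroup.coe_inv]
      fin_cases i <;> simp [Matrix.adjugate_fin_three, ha, h10, h20, h21]
    · rw [Matrix.SpecialLinearGroup.coe_inv]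
      fin_cases i <;> fin_cases j <;>
        simp [Matrix.adjugate_fin_three, ha, h10, h20, h21] at h ⊢

/-- The matrix representing the long Weyl element `w₀ = s_α s_β s_α` of `SL₃`. -/
def longWeylMatrix : Matrix (Fin 3) (Fin 3) ℝ :=
  !![0, 0, 1; 0, -1, 0; 1, 0, 0]

/-- The torus element `t(c₁, c₂) = diag(c₁, c₂ / c₁, 1 / c₂)`. -/
noncomputable def torusMatrix (c₁ c₂ : ℤ) : Matrix (Fin 3) (Fin 3) ℝ :=
  Matrix.diagonal ![(c₁ : ℝ), (c₂ : ℝ) / c₁, 1 / (c₂ : ℝ)]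

/-- `A = u_L w₀ t(c₁, c₂) u_R` with `u_L, u_R ∈ U(ℝ)`. -/
def IsBruhatDecomposition (c₁ c₂ : ℤ) (A : SL(3, ℤ)) (uL uR : SL(3, ℝ)) : Prop :=
  uL ∈ unipotentSubgroup ℝ ∧ uR ∈ unipotentSubgroup ℝ ∧
    (A : Matrix (Fin 3) (Fin 3) ℤ).map (Int.cast : ℤ → ℝ) =
      (uL : Matrix (Fin 3) (Fin 3) ℝ) * longWeylMatrix * torusMatrix c₁ c₂ *
        (uR : Matrix (Fin 3) (Fin 3) ℝ)

/-- The big cell Kloosterman set `Ω_{w₀}(c₁, c₂)`. -/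
def bigCellKloostermanSet (c₁ c₂ : ℤ) : Set SL(3, ℤ) :=
  {A | ∃ uL uR : SL(3, ℝ), IsBruhatDecomposition c₁ c₂ A uL uR}

/-- The relation on `Ω_{w₀}(c₁, c₂)` of lying in the same `U(ℤ)`-`U(ℤ)` double coset. -/
@[reducible] def kloostermanSetoid (c₁ c₂ : ℤ) : Setoid (bigCellKloostermanSet c₁ c₂) :=
  (DoubleCoset.setoid (unipotentSubgroup ℤ : Set SL(3, ℤ))
    (unipotentSubgroup ℤ : Set SL(3, ℤ))).comap Subtype.val

/-- `U(ℤ) \ Ω_{w₀}(c₁, c₂) / U(ℤ)`. For the long element `U^{w₀} = U`. -/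
def KloostermanDoubleCosets (c₁ c₂ : ℤ) : Type :=
  Quotient (kloostermanSetoid c₁ c₂)

/-- `e(x) = exp(2 π i x)`. -/
noncomputable def expTwoPiI (x : ℝ) : ℂ :=
  Complex.exp (2 * Real.pi * Complex.I * x)

/-- The additive character `ψ_n(u) = e(n₁ u₁₂ + n₂ u₂₃)` of `U(ℝ)`. -/
noncomputable def unipotentCharacter (n : Fin 2 → ℤ) (u : SL(3, ℝ)) : ℂ :=
  expTwoPiI (n 0 * u 0 1 + n 1 * u 1 2)

/-- The value `ψ_m(u_L) ψ_n(u_R)` at `A = u_L w₀ t(c₁, c₂) u_R`. -/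
noncomputable def kloostermanTerm (m n : Fin 2 → ℤ) (c₁ c₂ : ℤ)
    (A : bigCellKloostermanSet c₁ c₂) : ℂ :=
  unipotentCharacter m A.2.choose * unipotentCharacter n A.2.choose_spec.choose

theorem IsBruhatDecomposition.ne_zero {c₁ c₂ : ℤ} {A : SL(3, ℤ)} {uL uR : SL(3, ℝ)}
    (h : IsBruhatDecomposition c₁ c₂ A uL uR) : (c₁ : ℝ) ≠ 0 ∧ (c₂ : ℝ) ≠ 0 := by
  have hd := congrArg Matrix.det h.2.2
  have hA : ((A : Matrix (Fin 3) (Fin 3) ℤ).map (Int.cast : ℤ → ℝ)).det = 1 := by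
    have := (Int.castRingHom ℝ).map_det (A : Matrix (Fin 3) (Fin 3) ℤ)
    rw [A.det_coe] at this
    simpa using this.symm
  rw [hA] at hd
  simp only [Matrix.det_mul, Matrix.SpecialLinearGroup.det_coe, torusMatrix, Matrix.det_diagonal,
    Fin.prod_univ_three] at hd
  constructor <;> intro h0 <;> simp [h0] at hd

/-- The superdiagonal entries of `u_L` and `u_R` are determined by `A`. -/
theorem IsBruhatDecomposition.unique {c₁ c₂ : ℤ} {A : SL(3, ℤ)} {uL uR uL' uR' : SL(3, ℝ)}
    (h : IsBruhatDecomposition c₁ c₂ A uL uR) (h' : IsBruhatDecomposition c₁ c₂ A uL' uR') :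
    (uL 0 1 = uL' 0 1 ∧ uL 1 2 = uL' 1 2) ∧ (uR 0 1 = uR' 0 1 ∧ uR 1 2 = uR' 1 2) := by
  obtain ⟨h1, h2⟩ := h.ne_zero
  have key := h.2.2.symm.trans h'.2.2
  obtain ⟨⟨a1, a2⟩, ⟨b1, b2⟩, -⟩ := h
  obtain ⟨⟨a1', a2'⟩, ⟨b1', b2'⟩, -⟩ := h'
  have q : ∀ i j, _ := fun i j => congrFun (congrFun key i) j
  simp only [longWeylMatrix, torusMatrix, Matrix.mul_apply, Fin.sum_univ_three] at q
  have q20 := q 2 0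
  have q21 := q 2 1
  have q22 := q 2 2
  have q10 := q 1 0
  have q12 := q 1 2
  have q00 := q 0 0
  have q01 := q 0 1
  have a10 := a2 1 0 (by decide)
  have a20 := a2 2 0 (by decide)
  have a21 := a2 2 1 (by decide)
  have b10 := b2 1 0 (by decide)
  have b20 := b2 2 0 (by decide)
  have b21 := b2 2 1 (by decide)
  have a10' := a2' 1 0 (by decide)
  have a20' := a2' 2 0 (by decide)
  have a21' := a2' 2 1 (by decide)
  have b10' := b2' 1 0 (by decide)
  have b20' := b2' 2 0 (by decide)
  have b21' := b2' 2 1 (by decide)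
  simp [a1, b1, a1', b1', a10, a20, a21, b10, b20, b21, a10', a20', a21', b10', b20', b21', h1]
    at q21 q22 q10 q12 q00 q01
  rw [q00, q21] at q01
  rw [q10, q22] at q12
  simp [h1, h2] at q01 q12
  exact ⟨⟨q01, q10⟩, ⟨q21, q12⟩⟩

/-- The value at `A` may be computed from any decomposition of `A`. -/
theorem kloostermanTerm_eq (m n : Fin 2 → ℤ) {c₁ c₂ : ℤ} (A : bigCellKloostermanSet c₁ c₂)
    {uL uR : SL(3, ℝ)} (h : IsBruhatDecomposition c₁ c₂ A.1 uL uR) :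
    kloostermanTerm m n c₁ c₂ A = unipotentCharacter m uL * unipotentCharacter n uR := by
  obtain ⟨⟨p1, p2⟩, p3, p4⟩ := A.2.choose_spec.choose_spec.unique h
  simp only [kloostermanTerm, unipotentCharacter, p1, p2, p3, p4]

theorem unipotentCharacter_mul (n : Fin 2 → ℤ) {u v : SL(3, ℝ)} (hu : u ∈ unipotentSubgroup ℝ)
    (hv : v ∈ unipotentSubgroup ℝ) :
    unipotentCharacter n (u * v) = unipotentCharacter n u * unipotentCharacter n v := by
  have h1 : (u * v) 0 1 = u 0 1 + v 0 1 := by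
    have := hv.2 2 1 (by decide)
    simp [Matrix.SpecialLinearGroup.coe_mul, Matrix.mul_apply, Fin.sum_univ_three, hu.1, hv.1,
      this, add_comm]
  have h2 : (u * v) 1 2 = u 1 2 + v 1 2 := by
    have := hu.2 1 0 (by decide)
    simp [Matrix.SpecialLinearGroup.coe_mul, Matrix.mul_apply, Fin.sum_univ_three, hu.1, hv.1,
      this, add_comm]
  rw [unipotentCharacter, unipotentCharacter, unipotentCharacter, expTwoPiI, expTwoPiI, expTwoPiI,
    ← Complex.exp_add, h1, h2]
  congr 1
  push_cast
  ring

theorem map_mem_unipotentSubgroup {u : SL(3, ℤ)} (hu : u ∈ unipotentSubgroup ℤ) :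
    Matrix.SpecialLinearGroup.map (Int.castRingHom ℝ) u ∈ unipotentSubgroup ℝ := by
  refine ⟨fun i => ?_, fun i j h => ?_⟩
  · simp [hu.1 i]
  · simp [hu.2 i j h]

theorem unipotentCharacter_map (n : Fin 2 → ℤ) (u : SL(3, ℤ)) :
    unipotentCharacter n (Matrix.SpecialLinearGroup.map (Int.castRingHom ℝ) u) = 1 := by
  rw [unipotentCharacter, expTwoPiI, Complex.exp_eq_one_iff]
  refine ⟨n 0 * u 0 1 + n 1 * u 1 2, ?_⟩
  simp
  ring

/-- `ψ_m(u_L) ψ_n(u_R)` depends only on the double coset of `A`. -/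
theorem kloostermanTerm_congr (m n : Fin 2 → ℤ) (c₁ c₂ : ℤ) (A B : bigCellKloostermanSet c₁ c₂)
    (h : kloostermanSetoid c₁ c₂ A B) :
    kloostermanTerm m n c₁ c₂ A = kloostermanTerm m n c₁ c₂ B := by
  obtain ⟨u, hu, v, hv, hB⟩ := DoubleCoset.rel_iff.1 h
  obtain ⟨uL, uR, hA⟩ := A.2
  have hu' := map_mem_unipotentSubgroup hu
  have hv' := map_mem_unipotentSubgroup hv
  have hB' : IsBruhatDecomposition c₁ c₂ B.1
      (Matrix.SpecialLinearGroup.map (Int.castRingHom ℝ) u * uL)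
      (uR * Matrix.SpecialLinearGroup.map (Int.castRingHom ℝ) v) := by
    refine ⟨mul_mem hu' hA.1, mul_mem hA.2.1 hv', ?_⟩
    have e : (B.1 : Matrix (Fin 3) (Fin 3) ℤ).map (Int.cast : ℤ → ℝ) =
        (u : Matrix (Fin 3) (Fin 3) ℤ).map (Int.cast : ℤ → ℝ) *
          (A.1 : Matrix (Fin 3) (Fin 3) ℤ).map (Int.cast : ℤ → ℝ) *
          (v : Matrix (Fin 3) (Fin 3) ℤ).map (Int.cast : ℤ → ℝ) := by
      rw [hB]
      simp only [Matrix.SpecialLinearGroup.coe_mul]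
      exact ((Matrix.map_mul (f := Int.castRingHom ℝ)).trans
        (congrArg (· * _) (Matrix.map_mul (f := Int.castRingHom ℝ))))
    rw [e, hA.2.2]
    simp only [Matrix.SpecialLinearGroup.coe_mul, Matrix.mul_assoc]
    rfl
  rw [kloostermanTerm_eq m n A hA, kloostermanTerm_eq m n B hB', unipotentCharacter_mul m hu' hA.1,
    unipotentCharacter_mul n hA.2.1 hv', unipotentCharacter_map, unipotentCharacter_map, one_mul,
    mul_one]

/-- The long word `SL₃` Kloosterman sum
`S_{w₀}(m, n; (c₁, c₂)) = ∑ ψ_m(u_L) ψ_n(u_R)` over the double cosets of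
`A = u_L w₀ t(c₁, c₂) u_R` in `U(ℤ) \ Ω_{w₀}(c₁, c₂) / U(ℤ)`. -/
noncomputable def longWordKloostermanSum (m n : Fin 2 → ℤ) (c₁ c₂ : ℤ) : ℂ :=
  ∑ᶠ q : KloostermanDoubleCosets c₁ c₂,
    Quotient.lift (kloostermanTerm m n c₁ c₂) (kloostermanTerm_congr m n c₁ c₂) q

/-- The `SL₃` Ramanujan sum `R_{c₁,c₂}(n₁, n₂) = S_{w₀}(0, n; (c₁, c₂))`. -/
noncomputable def ramanujanSumSL3 (c₁ c₂ n₁ n₂ : ℤ) : ℂ :=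
  longWordKloostermanSum 0 ![n₁, n₂] c₁ c₂

/-- The classical Ramanujan sum `c_q(n) = ∑ e(u n / q)` over the reduced residues `u` mod `q`. -/
noncomputable def classicalRamanujanSum (q : ℕ) (n : ℤ) : ℂ :=
  ∑ u ∈ (Finset.range q).filter (fun u => Nat.gcd u q = 1), expTwoPiI ((u : ℝ) * n / q)

/-! Left multiplication by `U(ℤ)` preserves the bottom row `v` of `A` and the minors `m` of its
bottom two rows, and these determine the left coset. The only constraints are that `v` and `m` are
primitive and `v₀ m₁₂ - v₁ m₀₂ + v₂ m₀₁ = 0`. The cell is cut out by `v₀ = c₁`, `m₀₁ = c₂`, and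
there `ψ_n(u_R) = e(n₁ v₁ / c₁ + n₂ m₀₂ / c₂)`.

Put `f = gcd(c₁, v₁)`, `c₁ = f q`, `v₁ = f b`, `v₂ = d`. Primitivity of `v` means `gcd(d, f) = 1`;
the relation then forces `c₂ = f r` and `q m₁₂ - b m₀₂ = -d r`. If `q t - b s = 1`, the solutions
are `m₀₂ = q N - s d r`, `m₁₂ = b N - t d r`, and `m` is primitive iff `gcd(N, r) = 1`. Right
translation reduces `b` mod `q`, `d` mod `f` and `N = e + r k` mod `f r`
(`exists_bijective_doubleCosets`).

The sum over `k` gives `f` or `0` and produces the condition `f ∣ n₂ q`; the sums over `b`, `d`, `e`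
are classical Ramanujan sums (`sum_parameterTerm_fiber`). Taking `s` coprime to `f` removes it from
the `d`-sum. -/

/-! ### Additive characters, classical Ramanujan sums and Bézout pairs. -/

theorem expTwoPiI_add (x y : ℝ) : expTwoPiI (x + y) = expTwoPiI x * expTwoPiI y := by
  rw [expTwoPiI, expTwoPiI, expTwoPiI, ← Complex.exp_add]
  congr 1
  push_cast
  ring

theorem expTwoPiI_intCast (m : ℤ) : expTwoPiI m = 1 := by
  rw [expTwoPiI, Complex.exp_eq_one_iff]
  exact ⟨m, by push_cast; ring⟩

theorem expTwoPiI_natCast_mul (k : ℕ) (x : ℝ) : expTwoPiI (k * x) = expTwoPiI x ^ k := by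
  rw [expTwoPiI, expTwoPiI, ← Complex.exp_nat_mul]
  congr 1
  push_cast
  ring

theorem expTwoPiI_div_eq_one_iff {f : ℕ} (hf : 0 < f) (m : ℤ) :
    expTwoPiI ((m : ℝ) / f) = 1 ↔ (f : ℤ) ∣ m := by
  have hf' : (f : ℝ) ≠ 0 := by positivity
  constructor
  · intro h
    rw [expTwoPiI, Complex.exp_eq_one_iff] at h
    obtain ⟨k, hk⟩ := h
    refine ⟨k, ?_⟩
    have h2 : (2 * Real.pi * Complex.I : ℂ) ≠ 0 := Complex.two_pi_I_ne_zero
    have h3 : (((m : ℝ) / f : ℝ) : ℂ) = ((k : ℝ) : ℂ) := by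
      apply mul_left_cancel₀ h2
      rw [hk]
      push_cast
      ring
    have h4 : (m : ℝ) / f = k := by exact_mod_cast h3
    rw [div_eq_iff hf'] at h4
    have h5 : m = k * f := by exact_mod_cast h4
    rw [h5, mul_comm]
  · rintro ⟨k, rfl⟩
    rw [show (((f : ℤ) * k : ℤ) : ℝ) / f = k by push_cast; field_simp]
    exact expTwoPiI_intCast k

/-- Orthogonality of additive characters modulo `f`. -/
theorem sum_range_expTwoPiI {f : ℕ} (hf : 0 < f) (m : ℤ) :
    ∑ k ∈ Finset.range f, expTwoPiI ((m : ℝ) * k / f) = if (f : ℤ) ∣ m then (f : ℂ) else 0 := by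
  have hf' : (f : ℝ) ≠ 0 := by positivity
  have e : ∀ k : ℕ, expTwoPiI ((m : ℝ) * k / f) = expTwoPiI ((m : ℝ) / f) ^ k := fun k => by
    rw [← expTwoPiI_natCast_mul]
    congr 1
    ring
  simp only [e]
  split_ifs with h
  · simp [(expTwoPiI_div_eq_one_iff hf m).2 h]
  · have h1 : expTwoPiI ((m : ℝ) / f) ≠ 1 := fun h' => h ((expTwoPiI_div_eq_one_iff hf m).1 h')
    rw [geom_sum_eq h1, ← expTwoPiI_natCast_mul, mul_div_cancel₀ _ hf', expTwoPiI_intCast]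
    simp

theorem expTwoPiI_congr {q : ℕ} (hq : 0 < q) {a b : ℤ} (h : a ≡ b [ZMOD q]) :
    expTwoPiI ((a : ℝ) / q) = expTwoPiI ((b : ℝ) / q) := by
  obtain ⟨k, hk⟩ := h.symm.dvd
  have hq' : (q : ℝ) ≠ 0 := by positivity
  have : (a : ℝ) / q = b / q + k := by
    have : (a : ℝ) - b = q * k := by exact_mod_cast hk
    field_simp
    linarith
  rw [this, expTwoPiI_add, expTwoPiI_intCast, mul_one]

/-- The Ramanujan sum `c_q(n)` is unchanged when `n` is multiplied by a unit modulo `q`. -/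
theorem classicalRamanujanSum_mul_of_isCoprime {q : ℕ} (hq : 0 < q) {s : ℤ} (hs : IsCoprime s q)
    (n : ℤ) : classicalRamanujanSum q (s * n) = classicalRamanujanSum q n := by
  obtain ⟨a, b, hab⟩ := hs
  have hq' : (q : ℤ) ≠ 0 := by positivity
  have hpos : (0 : ℤ) < q := by positivity
  have ha : IsCoprime a (q : ℤ) := ⟨s, b, by linarith⟩
  have hs : IsCoprime s (q : ℤ) := ⟨a, b, hab⟩
  have cast : ∀ m : ℤ, ((m % q).toNat : ℤ) = m % q := fun m =>
    Int.toNat_of_nonneg (Int.emod_nonneg _ hq')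
  have mem : ∀ c : ℤ, IsCoprime c (q : ℤ) →
      ∀ u ∈ (Finset.range q).filter (fun u => Nat.gcd u q = 1),
        ((c * u) % q).toNat ∈ (Finset.range q).filter (fun u => Nat.gcd u q = 1) := by
    intro c hc u hu
    simp only [Finset.mem_filter, Finset.mem_range] at hu ⊢
    have h1 := Int.emod_lt_of_pos (c * u) hpos
    have h2 := cast (c * u)
    refine ⟨by omega, ?_⟩
    rw [← Nat.coprime_iff_gcd_eq_one, ← Nat.isCoprime_iff_coprime, h2]
    have h3 : IsCoprime (c * u) (q : ℤ) := hc.mul_left (Nat.isCoprime_iff_coprime.2 hu.2)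
    rw [Int.emod_def, sub_eq_add_neg, ← mul_neg]
    exact h3.add_mul_left_left _
  have inv : ∀ c c' : ℤ, c' * c ≡ 1 [ZMOD q] →
      ∀ u ∈ (Finset.range q).filter (fun u => Nat.gcd u q = 1),
        ((c' * (((c * u) % q).toNat : ℤ)) % q).toNat = u := by
    intro c c' hc u hu
    simp only [Finset.mem_filter, Finset.mem_range] at hu
    rw [cast]
    have h1 : c' * ((c * u) % q) ≡ u [ZMOD q] := by
      have := ((Int.mod_modEq (c * u) q).mul_left c').trans
        (by simpa [mul_assoc] using hc.mul_right (u : ℤ))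
      exact this
    rw [h1, Int.emod_eq_of_lt (by omega) (by omega)]
    simp
  have has : a * s ≡ 1 [ZMOD q] := by
    refine Int.modEq_iff_dvd.2 ⟨b, by linarith⟩
  unfold classicalRamanujanSum
  -- Multiplication by `s` permutes the reduced residues, with inverse multiplication by the Bézout
  -- coefficient `a`.
  refine Finset.sum_nbij' (fun u => ((s * u) % q).toNat) (fun u => ((a * u) % q).toNat)
    (mem s hs) (mem a ha) (inv s a has) (inv a s (by rwa [mul_comm])) ?_
  intro u _
  have := expTwoPiI_congr hq (((Int.mod_modEq (s * u) q).mul_right n).symm)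
  have h2 : ((((s * u) % q).toNat : ℕ) : ℝ) = (((s * u) % q : ℤ) : ℝ) := by
    exact_mod_cast congrArg (Int.cast : ℤ → ℝ) (cast (s * u))
  rw [h2, ← Int.cast_mul, ← this]
  congr 1
  push_cast
  ring

/-- A Bézout coefficient may be chosen coprime to a further modulus. -/
theorem exists_bezout_isCoprime {q b f : ℕ} (hq : 0 < q) (hf : 0 < f) (h : Nat.gcd b q = 1) :
    ∃ st : ℤ × ℤ, q * st.2 - b * st.1 = 1 ∧ IsCoprime st.1 f := by
  have : NeZero (q * f) := ⟨by positivity⟩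
  have hb : IsCoprime (b : ℤ) q := Nat.isCoprime_iff_coprime.2 h
  obtain ⟨x, y, hxy⟩ := hb
  have hx : IsCoprime (-x) (q : ℤ) := ⟨-b, y, by linarith⟩
  have hx' : IsUnit ((-x : ℤ) : ZMod q) := (ZMod.coe_int_isUnit_iff_isCoprime _ _).2 hx.symm
  -- Only the class of `s` mod `q` is prescribed, namely `-b⁻¹`; lifting this unit to modulus `q *
  -- f` makes `s` coprime to `f` as well.
  obtain ⟨u, hu⟩ := ZMod.unitsMap_surjective (Dvd.intro f rfl : q ∣ q * f) hx'.unit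
  have hu1 : IsCoprime ((u : ZMod (q * f)).val : ℤ) ((q * f : ℕ) : ℤ) := by
    refine ((ZMod.coe_int_isUnit_iff_isCoprime _ _).1 ?_).symm
    simp
  have hu2 : (((u : ZMod (q * f)).val : ℤ) : ZMod q) = ((-x : ℤ) : ZMod q) := by
    have := congrArg Units.val hu
    rw [ZMod.unitsMap_val, IsUnit.unit_spec] at this
    rw [← this]
    rw [Int.cast_natCast, ZMod.cast_eq_val]
  obtain ⟨k, hk⟩ := ((ZMod.intCast_eq_intCast_iff _ _ _).1 hu2).dvd
  refine ⟨(((u : ZMod (q * f)).val : ℤ), y - b * k), ?_, ?_⟩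
  · linear_combination hxy + b * hk
  · push_cast at hu1
    exact hu1.of_mul_right_right

/-! ### Bottom rows and minors as double coset invariants. -/

/-- The minor of the bottom two rows of `A` on the columns `i` and `j`. -/
def bottomMinor (A : SL(3, ℤ)) (i j : Fin 3) : ℤ := A 1 i * A 2 j - A 1 j * A 2 i

theorem bottom_row_mul_minors (A : SL(3, ℤ)) :
    A 2 0 * bottomMinor A 1 2 - A 2 1 * bottomMinor A 0 2 + A 2 2 * bottomMinor A 0 1 = 0 := by
  simp only [bottomMinor]
  ring

theorem top_row_mul_minors (A : SL(3, ℤ)) :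
    A 0 0 * bottomMinor A 1 2 - A 0 1 * bottomMinor A 0 2 + A 0 2 * bottomMinor A 0 1 = 1 := by
  have := A.det_coe
  rw [Matrix.det_fin_three] at this
  simp only [bottomMinor]
  linear_combination this

/-- The upper unipotent matrix with entries `x = u₁₂`, `y = u₂₃`, `z = u₁₃`. -/
def upperUnipotent {R : Type*} [CommRing R] (x y z : R) : SL(3, R) :=
  ⟨!![1, x, z; 0, 1, y; 0, 0, 1], by simp [Matrix.det_fin_three]⟩

theorem coe_upperUnipotent {R : Type*} [CommRing R] (x y z : R) :
    (upperUnipotent x y z : Matrix (Fin 3) (Fin 3) R) = !![1, x, z; 0, 1, y; 0, 0, 1] := rfl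

theorem upperUnipotent_mem {R : Type*} [CommRing R] (x y z : R) :
    upperUnipotent x y z ∈ unipotentSubgroup R := by
  refine ⟨fun i => ?_, fun i j h => ?_⟩
  · fin_cases i <;> simp [upperUnipotent]
  · fin_cases i <;> fin_cases j <;> simp [upperUnipotent] at h ⊢

theorem eq_upperUnipotent_of_mem {R : Type*} [CommRing R] {u : SL(3, R)}
    (hu : u ∈ unipotentSubgroup R) : u = upperUnipotent (u 0 1) (u 1 2) (u 0 2) := by
  have h10 := hu.2 1 0 (by decide)
  have h20 := hu.2 2 0 (by decide)
  have h21 := hu.2 2 1 (by decide)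
  ext i j
  fin_cases i <;> fin_cases j <;> simp [upperUnipotent, hu.1, h10, h20, h21]

/-- Two matrices lie in the same `U(ℤ)`-`U(ℤ)` double coset iff their bottom rows and bottom minors
are related by a right translation. -/
theorem doubleCoset_rel_iff (A B : SL(3, ℤ)) :
    DoubleCoset.setoid (unipotentSubgroup ℤ : Set SL(3, ℤ))
        (unipotentSubgroup ℤ : Set SL(3, ℤ)) A B ↔
      ∃ x y z : ℤ, B 2 0 = A 2 0 ∧ B 2 1 = A 2 1 + A 2 0 * x ∧
        B 2 2 = A 2 2 + A 2 1 * y + A 2 0 * z ∧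
        bottomMinor B 0 1 = bottomMinor A 0 1 ∧
        bottomMinor B 0 2 = bottomMinor A 0 2 + bottomMinor A 0 1 * y ∧
        bottomMinor B 1 2 = bottomMinor A 1 2 + bottomMinor A 0 2 * x +
          bottomMinor A 0 1 * (x * y - z) := by
  rw [DoubleCoset.rel_iff]
  constructor
  · rintro ⟨u, hu, v, hv, rfl⟩
    refine ⟨v 0 1, v 1 2, v 0 2, ?_⟩
    rw [eq_upperUnipotent_of_mem hu, eq_upperUnipotent_of_mem hv]
    simp only [bottomMinor, coe_upperUnipotent, Matrix.SpecialLinearGroup.coe_mul, Matrix.mul_apply,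
      Fin.sum_univ_three]
    simp
    refine ⟨?_, ?_, ?_, ?_, ?_⟩ <;> ring
  · rintro ⟨x, y, z, h1, h2, h3, h4, h5, h6⟩
    set v : SL(3, ℤ) := upperUnipotent x y z with hv
    have hC : ∃ C : SL(3, ℤ), C = A * v := ⟨_, rfl⟩
    obtain ⟨C, hCA⟩ := hC
    have c20 : B 2 0 = C 2 0 := by
      rw [hCA, hv, h1]
      simp [coe_upperUnipotent, Matrix.mul_apply, Fin.sum_univ_three]
    have c21 : B 2 1 = C 2 1 := by
      rw [hCA, hv, h2]
      simp [coe_upperUnipotent, Matrix.mul_apply, Fin.sum_univ_three]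
      ring
    have c22 : B 2 2 = C 2 2 := by
      rw [hCA, hv, h3]
      simp [coe_upperUnipotent, Matrix.mul_apply, Fin.sum_univ_three]
      ring
    have m01 : bottomMinor B 0 1 = bottomMinor C 0 1 := by
      rw [hCA, hv, h4]
      simp [bottomMinor, coe_upperUnipotent, Matrix.mul_apply, Fin.sum_univ_three]
      ring
    have m02 : bottomMinor B 0 2 = bottomMinor C 0 2 := by
      rw [hCA, hv, h5]
      simp [bottomMinor, coe_upperUnipotent, Matrix.mul_apply, Fin.sum_univ_three]
      ring
    have m12 : bottomMinor B 1 2 = bottomMinor C 1 2 := by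
      rw [hCA, hv, h6]
      simp [bottomMinor, coe_upperUnipotent, Matrix.mul_apply, Fin.sum_univ_three]
      ring
    -- `C = A * v` has the bottom row and minors of `B`. The entries of `C⁻¹` are cofactors of `C`,
    -- so these equalities make `B * C⁻¹` unipotent.
    refine ⟨B * C⁻¹, ?_, v, upperUnipotent_mem x y z, ?_⟩
    · have hB := top_row_mul_minors B
      have hC := top_row_mul_minors C
      have hC1 := C.det_coe
      rw [Matrix.det_fin_three] at hC1
      rw [m01, m02, m12] at hB
      simp only [bottomMinor] at *
      refine ⟨fun i => ?_, fun i j h => ?_⟩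
      · fin_cases i
        · simp [Matrix.adjugate_fin_three, Matrix.mul_apply, Fin.sum_univ_three]
          linear_combination hB
        · simp [Matrix.adjugate_fin_three, Matrix.mul_apply, Fin.sum_univ_three]
          simp only [c20, c21, c22] at m01 m02 m12 ⊢
          linear_combination hC + C 0 0 * m12 - C 0 1 * m02 + C 0 2 * m01
        · simp [Matrix.adjugate_fin_three, Matrix.mul_apply, Fin.sum_univ_three]
          rw [c20, c21, c22]
          linear_combination hC1
      · fin_cases i <;> fin_cases j <;>
          simp [Matrix.adjugate_fin_three, Matrix.mul_apply, Fin.sum_univ_three] at h ⊢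
        · linear_combination -B 1 0 * m12 + B 1 1 * m02 - B 1 2 * m01
        · rw [c20, c21, c22]; ring
        · rw [c20, c21, c22]; ring
    · rw [mul_assoc, ← hCA]
      simp

/-- Contracting the bivector `m` with a functional equal to `1` on `v` gives a middle row; the
incidence relation `h` ensures that its minors against `v` are `m`. Primitivity of `m` then supplies
a top row of determinant `1`. -/
theorem exists_of_bottom_row_of_minors {v₀ v₁ v₂ m₀₁ m₀₂ m₁₂ : ℤ}
    (h : v₀ * m₁₂ - v₁ * m₀₂ + v₂ * m₀₁ = 0)
    (hv : ∃ a b c, a * v₀ + b * v₁ + c * v₂ = 1)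
    (hm : ∃ a b c, a * m₀₁ + b * m₀₂ + c * m₁₂ = 1) :
    ∃ A : SL(3, ℤ), A 2 0 = v₀ ∧ A 2 1 = v₁ ∧ A 2 2 = v₂ ∧
      bottomMinor A 0 1 = m₀₁ ∧ bottomMinor A 0 2 = m₀₂ ∧ bottomMinor A 1 2 = m₁₂ := by
  obtain ⟨a, b, c, hv⟩ := hv
  obtain ⟨k, l, m, hm⟩ := hm
  have e01 : (b * m₀₁ + c * m₀₂) * v₁ - (c * m₁₂ - a * m₀₁) * v₀ = m₀₁ := by
    linear_combination m₀₁ * hv - c * h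
  have e02 : (b * m₀₁ + c * m₀₂) * v₂ - (-a * m₀₂ - b * m₁₂) * v₀ = m₀₂ := by
    linear_combination m₀₂ * hv + b * h
  have e12 : (c * m₁₂ - a * m₀₁) * v₂ - (-a * m₀₂ - b * m₁₂) * v₁ = m₁₂ := by
    linear_combination m₁₂ * hv - a * h
  refine ⟨⟨!![m, -l, k; b * m₀₁ + c * m₀₂, c * m₁₂ - a * m₀₁, -a * m₀₂ - b * m₁₂; v₀, v₁, v₂], ?_⟩,
    ?_⟩
  · rw [Matrix.det_fin_three]
    simp
    linear_combination hm + m * e12 + l * e02 + k * e01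
  · simp [bottomMinor]
    refine ⟨?_, ?_, ?_⟩
    · linear_combination e01
    · linear_combination e02
    · linear_combination e12

/-! ### Bruhat decomposition in terms of these invariants. -/

theorem isBruhatDecomposition_entries {c₁ c₂ : ℤ} {A : SL(3, ℤ)} {uL uR : SL(3, ℝ)}
    (h : IsBruhatDecomposition c₁ c₂ A uL uR) : A 2 0 = c₁ ∧ bottomMinor A 0 1 = c₂ := by
  obtain ⟨h1, h2⟩ := h.ne_zero
  obtain ⟨hL, hR, key⟩ := h
  rw [eq_upperUnipotent_of_mem hL, eq_upperUnipotent_of_mem hR] at key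
  have q : ∀ i j, _ := fun i j => congrFun (congrFun key i) j
  simp only [longWeylMatrix, torusMatrix, Matrix.mul_apply, Fin.sum_univ_three,
    coe_upperUnipotent] at q
  have q20 := q 2 0
  have q21 := q 2 1
  have q10 := q 1 0
  have q11 := q 1 1
  simp at q20 q21 q10 q11
  refine ⟨by exact_mod_cast q20, ?_⟩
  have : ((bottomMinor A 0 1 : ℤ) : ℝ) = c₂ := by
    simp only [bottomMinor]
    push_cast
    rw [q20, q21, q10, q11]
    field_simp
    ring
  exact_mod_cast this

/-- `u_L` does not affect the bottom row and minors, so `u_R` is read off from those of `w₀ t u_R`: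
the row is `c₁ (1, x, z)` and the first two minors are `c₂ (1, y)`. -/
theorem exists_isBruhatDecomposition {c₁ c₂ : ℤ} (h1 : c₁ ≠ 0) (h2 : c₂ ≠ 0) {A : SL(3, ℤ)}
    (hA : A 2 0 = c₁) (hA' : bottomMinor A 0 1 = c₂) :
    ∃ uL : SL(3, ℝ), IsBruhatDecomposition c₁ c₂ A uL
      (upperUnipotent ((A 2 1 : ℝ) / c₁) ((bottomMinor A 0 2 : ℝ) / c₂) ((A 2 2 : ℝ) / c₁)) := by
  have h1' : (c₁ : ℝ) ≠ 0 := by exact_mod_cast h1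
  have h2' : (c₂ : ℝ) ≠ 0 := by exact_mod_cast h2
  refine ⟨upperUnipotent (((A 0 0 * A 2 1 - A 0 1 * A 2 0 : ℤ) : ℝ) / c₂) ((A 1 0 : ℝ) / c₁)
    ((A 0 0 : ℝ) / c₁), upperUnipotent_mem _ _ _, upperUnipotent_mem _ _ _, ?_⟩
  have t := top_row_mul_minors A
  have r0 : (A 2 0 : ℝ) = c₁ := by exact_mod_cast hA
  have r1 : (A 1 0 * A 2 1 - A 1 1 * A 2 0 : ℝ) = c₂ := by exact_mod_cast hA'
  have r2 : (A 0 0 * (A 1 1 * A 2 2 - A 1 2 * A 2 1) - A 0 1 * (A 1 0 * A 2 2 - A 1 2 * A 2 0) +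
    A 0 2 * (A 1 0 * A 2 1 - A 1 1 * A 2 0) : ℝ) = 1 := by exact_mod_cast t
  ext i j
  simp only [bottomMinor, longWeylMatrix, torusMatrix, Matrix.mul_apply, Fin.sum_univ_three,
    coe_upperUnipotent]
  fin_cases i <;> fin_cases j <;> simp
  all_goals try field_simp
  · linear_combination -(A 0 1 : ℝ) * r0
  · rw [← r1, ← r0]
    linear_combination (A 2 0 : ℝ) * r2
  · linear_combination -(A 1 1 : ℝ) * r0 - r1
  · linear_combination -(A 1 2 : ℝ) * r0
  · exact hA

/-! ### Parametrisation of the double cosets. -/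

/-- A chosen pair `(s, t)` with `q t - b s = 1` and `s` coprime to `f`. -/
noncomputable def bezoutPair (q b f : ℕ) : ℤ × ℤ :=
  Classical.epsilon fun st : ℤ × ℤ => q * st.2 - b * st.1 = 1 ∧ IsCoprime st.1 f

theorem bezoutPair_spec {q b f : ℕ} (hq : 0 < q) (hf : 0 < f) (h : Nat.gcd b q = 1) :
    q * (bezoutPair q b f).2 - b * (bezoutPair q b f).1 = 1 ∧ IsCoprime (bezoutPair q b f).1 f :=
  Classical.epsilon_spec (exists_bezout_isCoprime hq hf h)

/-- The least nonnegative reduced residues modulo `q`. -/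
def reducedResidues (q : ℕ) : Finset ℕ := (Finset.range q).filter (fun u => Nat.gcd u q = 1)

theorem mem_reducedResidues {q u : ℕ} : u ∈ reducedResidues q ↔ u < q ∧ Nat.gcd u q = 1 := by
  simp [reducedResidues]

/-- Parameters `(f, b, d, e, k)` for the double cosets in `Ω(c₁, c₂)`. -/
def doubleCosetParameters (c₁ c₂ : ℕ) : Finset (Σ _ : ℕ, ℕ × ℕ × ℕ × ℕ) :=
  (Nat.gcd c₁ c₂).divisors.sigma fun f =>
    reducedResidues (c₁ / f) ×ˢ reducedResidues f ×ˢ reducedResidues (c₂ / f) ×ˢ Finset.range f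

/-- `A` has the bottom row and the bottom minors prescribed by the parameters `(f, b, d, e, k)`. -/
def HasParameters (c₁ c₂ : ℕ) : (Σ _ : ℕ, ℕ × ℕ × ℕ × ℕ) → SL(3, ℤ) → Prop
  | ⟨f, b, d, e, k⟩, A =>
    A 2 0 = c₁ ∧ A 2 1 = f * b ∧ A 2 2 = d ∧ bottomMinor A 0 1 = c₂ ∧
      bottomMinor A 0 2 = (c₁ / f : ℕ) * (e + (c₂ / f : ℕ) * k) -
        (bezoutPair (c₁ / f) b f).1 * d * (c₂ / f : ℕ) ∧
      bottomMinor A 1 2 = b * (e + (c₂ / f : ℕ) * k) -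
        (bezoutPair (c₁ / f) b f).2 * d * (c₂ / f : ℕ)

theorem mem_doubleCosetParameters {c₁ c₂ f b d e k : ℕ} (hc₁ : 0 < c₁) (hc₂ : 0 < c₂) :
    (⟨f, b, d, e, k⟩ : Σ _ : ℕ, ℕ × ℕ × ℕ × ℕ) ∈ doubleCosetParameters c₁ c₂ ↔
      0 < f ∧ ∃ q r, 0 < q ∧ 0 < r ∧ c₁ = f * q ∧ c₂ = f * r ∧ c₁ / f = q ∧ c₂ / f = r ∧
        (b < q ∧ Nat.gcd b q = 1) ∧ (d < f ∧ Nat.gcd d f = 1) ∧ (e < r ∧ Nat.gcd e r = 1) ∧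
          k < f := by
  simp only [doubleCosetParameters, Finset.mem_sigma, Finset.mem_product, mem_reducedResidues,
    Finset.mem_range, Nat.mem_divisors, Nat.dvd_gcd_iff]
  constructor
  · rintro ⟨⟨⟨⟨q, rfl⟩, ⟨r, rfl⟩⟩, -⟩, h1, h2, h3, h4⟩
    have hf : 0 < f := Nat.pos_of_mul_pos_right hc₁
    rw [Nat.mul_div_cancel_left _ hf] at h1 h3
    exact ⟨hf, q, r, Nat.pos_of_mul_pos_left hc₁, Nat.pos_of_mul_pos_left hc₂, rfl, rfl,
      Nat.mul_div_cancel_left _ hf, Nat.mul_div_cancel_left _ hf, h1, h2, h3, h4⟩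
  · rintro ⟨hf, q, r, -, -, h1, h2, h3, h4, h5, h6, h7, h8⟩
    rw [h3, h4]
    exact ⟨⟨⟨⟨q, h1⟩, ⟨r, h2⟩⟩, (Nat.gcd_pos_of_pos_left _ hc₁).ne'⟩, h5, h6, h7, h8⟩

theorem exists_hasParameters {c₁ c₂ : ℕ} (hc₁ : 0 < c₁) (hc₂ : 0 < c₂)
    {i : Σ _ : ℕ, ℕ × ℕ × ℕ × ℕ} (hi : i ∈ doubleCosetParameters c₁ c₂) :
    ∃ A : SL(3, ℤ), HasParameters c₁ c₂ i A := by
  obtain ⟨f, b, d, e, k⟩ := i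
  obtain ⟨hf, q, r, hq, hr, rfl, rfl, hq', hr', ⟨-, hb⟩, ⟨-, hd⟩, ⟨-, he⟩, -⟩ :=
    (mem_doubleCosetParameters hc₁ hc₂).1 hi
  obtain ⟨hst, -⟩ := bezoutPair_spec hq hf hb
  simp only [HasParameters, hq', hr']
  generalize bezoutPair q b f = st at *
  obtain ⟨s, t⟩ := st
  simp only at *
  obtain ⟨β, α, hd⟩ := Nat.isCoprime_iff_coprime.2 hd
  obtain ⟨μ, ν, he⟩ := Nat.isCoprime_iff_coprime.2 he
  push_cast
  set E : ℤ := e + r * k with hE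
  have he : μ * E + (ν - μ * k) * r = 1 := by rw [hE]; linear_combination he
  -- The pair `(t, -s)` extracts `f` from `(f q, f b)` and `E` from `(m₀₂, m₁₂)`, while `(b, -q)`
  -- extracts `d r` from the latter. Coprimality of `d, f` and of `E, r` then combines these to `1`.
  refine exists_of_bottom_row_of_minors ?_ ⟨α * t, -(α * s), β, ?_⟩
    ⟨(ν - μ * k) * α, μ * t - (ν - μ * k) * β * -(b : ℤ), -(μ * s) - (ν - μ * k) * β * q, ?_⟩
  · linear_combination (-(f : ℤ) * d * r) * hst
  · linear_combination α * f * hst + hd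
  · linear_combination (μ * E + (ν - μ * k) * β * d * r) * hst + (ν - μ * k) * r * hd + he

theorem natCast_dvd_of_dvd_mul {f g b q : ℕ} (h : Nat.gcd b q = 1) (hq : f ∣ g * q)
    (hb : (f : ℤ) ∣ g * b) : f ∣ g := by
  have hb : f ∣ g * b := by exact_mod_cast hb
  have := Nat.dvd_gcd hb hq
  rwa [Nat.gcd_mul_left, h, mul_one] at this

theorem eq_of_intCast_dvd_sub {q a b : ℕ} (ha : a < q) (hb : b < q) (h : (q : ℤ) ∣ b - a) :
    a = b :=
  Nat.ModEq.eq_of_lt_of_lt (Nat.modEq_iff_dvd.2 h) ha hb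

theorem add_mul_lt_mul {e r k f : ℕ} (he : e < r) (hk : k < f) : e + r * k < f * r := by
  calc e + r * k < r + r * k := by omega
    _ = (k + 1) * r := by ring
    _ ≤ f * r := Nat.mul_le_mul_right _ hk

/-- Right translation preserves `f = gcd(c₁, v₁)`. The reduced ranges then fix `b`, forcing `x = 0`,
and after that `d` and finally `e + r k` mod `f r`. -/
theorem hasParameters_unique {c₁ c₂ : ℕ} (hc₁ : 0 < c₁) (hc₂ : 0 < c₂)
    {i j : Σ _ : ℕ, ℕ × ℕ × ℕ × ℕ} (hi : i ∈ doubleCosetParameters c₁ c₂)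
    (hj : j ∈ doubleCosetParameters c₁ c₂) {A B : SL(3, ℤ)} (hA : HasParameters c₁ c₂ i A)
    (hB : HasParameters c₁ c₂ j B)
    (h : DoubleCoset.setoid (unipotentSubgroup ℤ : Set SL(3, ℤ))
      (unipotentSubgroup ℤ : Set SL(3, ℤ)) A B) : i = j := by
  obtain ⟨f, b, d, e, k⟩ := i
  obtain ⟨f', b', d', e', k'⟩ := j
  obtain ⟨hf, q, r, hq, hr, h1, h2, hq', hr', ⟨hbq, hb⟩, ⟨hdf, hd⟩, ⟨her, he⟩, hk⟩ :=
    (mem_doubleCosetParameters hc₁ hc₂).1 hi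
  obtain ⟨hf', q', r', _, _, h1', h2', hq'', hr'', ⟨hbq', hb'⟩, ⟨hdf', hd'⟩, ⟨her', he'⟩, hk'⟩ :=
    (mem_doubleCosetParameters hc₁ hc₂).1 hj
  obtain ⟨x, y, z, -, g1, g2, -, g3, g4⟩ := (doubleCoset_rel_iff A B).1 h
  obtain ⟨a0, a1, a2, m0, m1, m2⟩ := hA
  obtain ⟨-, b1, b2, -, n1, n2⟩ := hB
  rw [a1, b1, a0] at g1
  have hff : f = f' := by
    refine Nat.dvd_antisymm (natCast_dvd_of_dvd_mul hb' ⟨q, by rw [← h1, h1']⟩ ?_)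
      (natCast_dvd_of_dvd_mul hb ⟨q', by rw [← h1, h1']⟩ ?_)
    · rw [g1, h1]
      exact ⟨b + q * x, by push_cast; ring⟩
    · rw [eq_sub_of_add_eq g1.symm, h1']
      exact ⟨b' - q' * x, by push_cast; ring⟩
  subst hff
  obtain rfl : q = q' := hq'.symm.trans hq''
  obtain rfl : r = r' := hr'.symm.trans hr''
  have hf0 : (f : ℤ) ≠ 0 := by positivity
  have g1' : (b' : ℤ) - b = q * x := by
    apply mul_left_cancel₀ hf0
    rw [h1] at g1
    push_cast at g1
    linear_combination g1
  obtain rfl : b = b' := eq_of_intCast_dvd_sub hbq hbq' ⟨x, g1'⟩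
  obtain rfl : x = 0 := by simpa [hq.ne'] using g1'
  rw [a0, a1, a2, b2, h1] at g2
  push_cast at g2
  obtain rfl : d = d' := eq_of_intCast_dvd_sub hdf hdf' ⟨b * y + q * z, by linear_combination g2⟩
  rw [m1, n1, m0, hq', hr', h2] at g3
  rw [m2, n2, m0, hq', hr', h2] at g4
  obtain ⟨hst, -⟩ := bezoutPair_spec hq hf hb
  push_cast at g3 g4
  generalize (bezoutPair q b f).1 = s at *
  generalize (bezoutPair q b f).2 = t at *
  clear n1 n2 m1 m2 m0
  have hE : e + r * k = e' + r * k' := by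
    refine eq_of_intCast_dvd_sub (add_mul_lt_mul her hk) (add_mul_lt_mul her' hk')
      ⟨t * y + s * z, ?_⟩
    push_cast
    linear_combination (-(e' + r * k' - e - r * k : ℤ)) * hst + t * g3 - s * g4
  obtain rfl : e = e' := by
    have := congrArg (· % r) hE
    simpa [Nat.mod_eq_of_lt her, Nat.mod_eq_of_lt her'] using this
  obtain rfl : k = k' := Nat.eq_of_mul_eq_mul_left hr (Nat.add_left_cancel hE)
  rfl

theorem exists_natCast_eq_add_mul (m : ℤ) {q : ℕ} (hq : 0 < q) :
    ∃ (u : ℕ) (x : ℤ), u < q ∧ (u : ℤ) = m + q * x := by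
  have h1 := Int.emod_nonneg m (by positivity : (q : ℤ) ≠ 0)
  have h2 := Int.emod_lt_of_pos m (by positivity : (0 : ℤ) < q)
  refine ⟨(m % q).toNat, -(m / q), by omega, ?_⟩
  rw [Int.toNat_of_nonneg h1, Int.emod_def]
  ring

theorem exists_parameters {c₁ c₂ : ℕ} (hc₁ : 0 < c₁) (hc₂ : 0 < c₂) {A : SL(3, ℤ)}
    (hA : A 2 0 = c₁) (hA' : bottomMinor A 0 1 = c₂) :
    ∃ i ∈ doubleCosetParameters c₁ c₂, ∀ B, HasParameters c₁ c₂ i B →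
      DoubleCoset.setoid (unipotentSubgroup ℤ : Set SL(3, ℤ))
        (unipotentSubgroup ℤ : Set SL(3, ℤ)) A B := by
  have hrow := bottom_row_mul_minors A
  have htop := top_row_mul_minors A
  have hdet := A.det_coe
  rw [Matrix.det_fin_three] at hdet
  simp only [doubleCoset_rel_iff]
  rw [hA] at hrow hdet ⊢
  rw [hA'] at hrow htop ⊢
  clear hA hA'
  generalize bottomMinor A 0 2 = E at *
  generalize bottomMinor A 1 2 = G at *
  generalize A 2 1 = b₀ at *
  generalize A 2 2 = d₀ at *
  obtain ⟨f, hf, q, b₁, hcop, rfl, rfl⟩ : ∃ f : ℕ, 0 < f ∧ ∃ (q : ℕ) (b₁ : ℤ),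
      IsCoprime b₁ q ∧ c₁ = f * q ∧ b₀ = f * b₁ := by
    have hg : 0 < Int.gcd b₀ c₁ := Int.gcd_pos_of_ne_zero_right _ (by positivity)
    obtain ⟨b₁, hb₁⟩ := Int.gcd_dvd_left b₀ c₁
    obtain ⟨q, hq⟩ := Int.natCast_dvd_natCast.1 (Int.gcd_dvd_right b₀ c₁)
    refine ⟨_, hg, q, b₁, ?_, hq, hb₁⟩
    have hb := Int.gcd_eq_gcd_ab b₀ c₁
    refine ⟨Int.gcdA b₀ c₁, Int.gcdB b₀ c₁, ?_⟩
    have hg0 : (Int.gcd b₀ c₁ : ℤ) ≠ 0 := by positivity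
    apply mul_left_cancel₀ hg0
    have hq' : (c₁ : ℤ) = (Int.gcd b₀ c₁ : ℤ) * q := by exact_mod_cast hq
    linear_combination -hb - Int.gcdA b₀ c₁ * hb₁ - Int.gcdB b₀ c₁ * hq'
  have hq : 0 < q := Nat.pos_of_mul_pos_left hc₁
  have hf0 : (f : ℤ) ≠ 0 := by positivity
  push_cast at hdet hrow
  -- Expand the determinant along the bottom row, whose first two entries are multiples of `f`.
  have hd₀ : IsCoprime d₀ f := ⟨A 0 0 * A 1 1 - A 0 1 * A 1 0,
    -A 0 0 * A 1 2 * b₁ + A 0 1 * A 1 2 * q + A 0 2 * A 1 0 * b₁ - A 0 2 * A 1 1 * q,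
    by linear_combination hdet⟩
  obtain ⟨r, rfl⟩ : f ∣ c₂ := by
    have : (f : ℤ) ∣ d₀ * c₂ := ⟨b₁ * E - q * G, by linear_combination hrow⟩
    exact Int.natCast_dvd_natCast.1 (hd₀.symm.dvd_of_dvd_mul_left this)
  have hr : 0 < r := Nat.pos_of_mul_pos_left hc₂
  push_cast at htop hrow
  have hrow' : q * G - b₁ * E + d₀ * r = 0 := by
    apply mul_left_cancel₀ hf0
    linear_combination hrow
  obtain ⟨b, x, hbq, hb⟩ := exists_natCast_eq_add_mul b₁ hq
  have hbc : Nat.gcd b q = 1 := by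
    refine Nat.isCoprime_iff_coprime.1 ?_
    rw [hb]
    exact hcop.add_mul_left_left x
  obtain ⟨d, w, hdf, hd⟩ := exists_natCast_eq_add_mul d₀ hf
  have hdc : Nat.gcd d f = 1 := by
    refine Nat.isCoprime_iff_coprime.1 ?_
    rw [hd]
    exact hd₀.add_mul_left_left w
  obtain ⟨hst, -⟩ := bezoutPair_spec hq hf hbc
  set s := (bezoutPair q b f).1 with hs
  set t := (bezoutPair q b f).2 with ht
  -- `G + E * x` is the last minor after translating by `x`. The combination is the free parameter
  -- of the solution of `hG`, as `hE1` and `hG1` confirm; its base-`r` digits will be `e` and `k`.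
  obtain ⟨e', h, her, he⟩ := exists_natCast_eq_add_mul (t * E - s * (G + E * x)) (Nat.mul_pos hf hr)
  have hG : q * (G + E * x) - b * E = -(d₀ * r) := by
    rw [hb]
    linear_combination hrow'
  have hE1 : E = q * (t * E - s * (G + E * x)) - s * d₀ * r := by
    linear_combination (-E) * hst + s * hG
  have hG1 : G + E * x = b * (t * E - s * (G + E * x)) - t * d₀ * r := by
    linear_combination (-(G + E * x)) * hst + t * hG
  have hec : Nat.gcd (e' % r) r = 1 := by
    rw [← Nat.gcd_rec, Nat.gcd_comm]
    refine Nat.isCoprime_iff_coprime.1 ?_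
    rw [he]
    push_cast
    rw [show (f * r * h : ℤ) = r * (f * h) by ring]
    refine IsCoprime.add_mul_left_left (y := (r : ℤ)) ?_ _
    refine ⟨A 0 0 * (b - q * x) - A 0 1 * q,
      A 0 0 * (-(t * d₀) + s * d₀ * x) + A 0 1 * s * d₀ + A 0 2 * f, ?_⟩
    linear_combination htop + (-A 0 0) * hG1 + (A 0 0 * x + A 0 1) * hE1
  have hdm := Nat.mod_add_div e' r
  have hdm' : ((e' % r : ℕ) : ℤ) + r * (e' / r : ℕ) = e' := by exact_mod_cast hdm
  refine ⟨⟨f, b, d, e' % r, e' / r⟩, (mem_doubleCosetParameters hc₁ hc₂).2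
    ⟨hf, q, r, hq, hr, rfl, rfl, Nat.mul_div_cancel_left _ hf, Nat.mul_div_cancel_left _ hf,
      ⟨hbq, hbc⟩, ⟨hdf, hdc⟩, ⟨Nat.mod_lt _ hr, hec⟩, ?_⟩, ?_⟩
  · exact Nat.div_lt_of_lt_mul (by rwa [mul_comm])
  · rintro B ⟨a0, a1, a2, m0, m1, m2⟩
    rw [Nat.mul_div_cancel_left _ hf, Nat.mul_div_cancel_left _ hf, hdm'] at m1 m2
    rw [← hs] at m1
    rw [← ht] at m2
    -- `w` and `h` are the quotients discarded in reducing `d₀` and the free parameter. Matching the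
    -- two minors determines `y` and `z`; the bottom row then agrees by `hst`.
    refine ⟨x, -(w * s) + h * q, -(h * b) + w * t + x * (-(w * s) + h * q), a0, ?_, ?_, m0, ?_, ?_⟩
    · rw [a1, hb]
      push_cast
      ring
    · rw [a2, hd]
      push_cast
      linear_combination (-(f : ℤ) * w) * hst + f * (-(w * s) + h * q) * hb
    · rw [m1]
      push_cast at he ⊢
      linear_combination q * he - s * r * hd - hE1
    · rw [m2]
      push_cast at he ⊢
      linear_combination b * he - t * r * hd - hG1

theorem HasParameters.mem_bigCell {c₁ c₂ : ℕ} (hc₁ : 0 < c₁) (hc₂ : 0 < c₂)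
    {i : Σ _ : ℕ, ℕ × ℕ × ℕ × ℕ} {A : SL(3, ℤ)} (hA : HasParameters c₁ c₂ i A) :
    A ∈ bigCellKloostermanSet c₁ c₂ := by
  obtain ⟨f, b, d, e, k⟩ := i
  obtain ⟨a0, -, -, m0, -, -⟩ := hA
  obtain ⟨uL, h⟩ := exists_isBruhatDecomposition (by positivity) (by positivity) a0 m0
  exact ⟨uL, _, h⟩

/-- The double cosets in `Ω(c₁, c₂)` correspond to the parameters. -/
theorem exists_bijective_doubleCosets {c₁ c₂ : ℕ} (hc₁ : 0 < c₁) (hc₂ : 0 < c₂) :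
    ∃ F : doubleCosetParameters c₁ c₂ → bigCellKloostermanSet c₁ c₂,
      (∀ i, HasParameters c₁ c₂ i.1 (F i).1) ∧
        Function.Bijective fun i => (Quotient.mk (kloostermanSetoid c₁ c₂) (F i)) := by
  choose F hF using fun i : doubleCosetParameters c₁ c₂ => exists_hasParameters hc₁ hc₂ i.2
  refine ⟨fun i => ⟨F i, (hF i).mem_bigCell hc₁ hc₂⟩, hF, ?_, ?_⟩
  · intro i j hij
    exact Subtype.ext (hasParameters_unique hc₁ hc₂ i.2 j.2 (hF i) (hF j)
      (Quotient.exact (s := kloostermanSetoid c₁ c₂) hij))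
  · intro Q
    obtain ⟨⟨A, uL, uR, hA⟩, rfl⟩ := Quotient.exists_rep Q
    obtain ⟨h1, h2⟩ := isBruhatDecomposition_entries hA
    obtain ⟨i, hi, h⟩ := exists_parameters hc₁ hc₂ h1 h2
    exact ⟨⟨i, hi⟩, (Quotient.sound (s := kloostermanSetoid c₁ c₂)
      (h _ (hF ⟨i, hi⟩))).symm⟩

theorem finite_kloostermanDoubleCosets {c₁ c₂ : ℕ} (hc₁ : 0 < c₁) (hc₂ : 0 < c₂) :
    Finite (KloostermanDoubleCosets c₁ c₂) := by
  obtain ⟨F, -, hF⟩ := exists_bijective_doubleCosets hc₁ hc₂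
  exact Finite.of_surjective _ hF.2

/-! ### Evaluation of the sum. -/

/-- The summand of the Ramanujan sum attached to the parameters `(f, b, d, e, k)`. -/
noncomputable def parameterTerm (c₁ c₂ : ℕ) (n₁ n₂ : ℤ) : (Σ _ : ℕ, ℕ × ℕ × ℕ × ℕ) → ℂ
  | ⟨f, b, d, e, k⟩ =>
    expTwoPiI ((b : ℝ) * n₁ / (c₁ / f : ℕ)) *
      (expTwoPiI ((d : ℝ) * ((-(bezoutPair (c₁ / f) b f).1 * n₂ : ℤ) : ℝ) / f) *
        (expTwoPiI ((e : ℝ) * ((c₁ / f : ℕ) * n₂) / c₂) *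
          expTwoPiI (((n₂ * (c₁ / f : ℕ) : ℤ) : ℝ) * k / f)))

/-- The first factor is `e(n₁ v₁ / c₁)`; the other three split `e(n₂ m₀₂ / c₂)` along the `d`, `e`
and `k` parts of `m₀₂`. -/
theorem HasParameters.kloostermanTerm_eq {c₁ c₂ : ℕ} (hc₁ : 0 < c₁) (hc₂ : 0 < c₂) (n₁ n₂ : ℤ)
    {i : Σ _ : ℕ, ℕ × ℕ × ℕ × ℕ} (hi : i ∈ doubleCosetParameters c₁ c₂)
    {A : bigCellKloostermanSet c₁ c₂} (hA : HasParameters c₁ c₂ i A.1) :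
    kloostermanTerm 0 ![n₁, n₂] c₁ c₂ A = parameterTerm c₁ c₂ n₁ n₂ i := by
  obtain ⟨f, b, d, e, k⟩ := i
  obtain ⟨a0, a1, -, m0, m1, -⟩ := hA
  obtain ⟨uL, h⟩ := exists_isBruhatDecomposition (by positivity) (by positivity) a0 m0
  obtain ⟨hf, q, r, hq, hr, rfl, rfl, hq', hr', -⟩ := (mem_doubleCosetParameters hc₁ hc₂).1 hi
  rw [_root_.kloostermanTerm_eq _ _ A h, a1, m1]
  simp only [parameterTerm, hq', hr', unipotentCharacter, ← expTwoPiI_add, coe_upperUnipotent]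
  congr 1
  have hf' : (f : ℝ) ≠ 0 := by positivity
  have hq'' : (q : ℝ) ≠ 0 := by positivity
  have hr'' : (r : ℝ) ≠ 0 := by positivity
  simp
  field_simp
  ring

theorem ramanujanSumSL3_eq_sum {c₁ c₂ : ℕ} (hc₁ : 0 < c₁) (hc₂ : 0 < c₂) (n₁ n₂ : ℤ) :
    ramanujanSumSL3 c₁ c₂ n₁ n₂ =
      ∑ i ∈ doubleCosetParameters c₁ c₂, parameterTerm c₁ c₂ n₁ n₂ i := by
  obtain ⟨F, hF, hbij⟩ := exists_bijective_doubleCosets hc₁ hc₂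
  rw [← Finset.sum_coe_sort, ← finsum_eq_sum_of_fintype]
  refine (finsum_eq_of_bijective _ hbij fun i => ?_).symm
  exact ((hF i).kloostermanTerm_eq hc₁ hc₂ n₁ n₂ i.2).symm

theorem classicalRamanujanSum_eq (q : ℕ) (n : ℤ) :
    classicalRamanujanSum q n = ∑ u ∈ reducedResidues q, expTwoPiI ((u : ℝ) * n / q) := rfl

theorem sum_parameterTerm_fiber {c₁ c₂ f : ℕ} (hc₁ : 0 < c₁) (hc₂ : 0 < c₂)
    (hf : f ∈ (Nat.gcd c₁ c₂).divisors) (n₁ n₂ : ℤ) :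
    ∑ x ∈ reducedResidues (c₁ / f) ×ˢ reducedResidues f ×ˢ reducedResidues (c₂ / f) ×ˢ
        Finset.range f, parameterTerm c₁ c₂ n₁ n₂ ⟨f, x⟩ =
      if (f : ℤ) ∣ n₂ * ((c₁ / f : ℕ) : ℤ) then
        (f : ℂ) * classicalRamanujanSum (c₁ / f) n₁ * classicalRamanujanSum f n₂ *
          classicalRamanujanSum (c₂ / f) ((c₁ : ℤ) * n₂ / (f : ℤ) ^ 2)
      else 0 := by
  obtain ⟨⟨q, rfl⟩, ⟨r, rfl⟩⟩ := Nat.dvd_gcd_iff.1 (Nat.dvd_of_mem_divisors hf)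
  have hf : 0 < f := Nat.pos_of_mul_pos_right hc₁
  have hq : 0 < q := Nat.pos_of_mul_pos_left hc₁
  have hr : 0 < r := Nat.pos_of_mul_pos_left hc₂
  simp only [Finset.sum_product, parameterTerm, Nat.mul_div_cancel_left _ hf, ← Finset.mul_sum]
  rw [sum_range_expTwoPiI hf]
  split_ifs with h
  · obtain ⟨m, hm⟩ := h
    have hf0 : (f : ℤ) ≠ 0 := by positivity
    -- The integer division is exact precisely because the `k`-sum left `f ∣ n₂ q`.
    have hm' : ((f * q : ℕ) : ℤ) * n₂ / (f : ℤ) ^ 2 = m := by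
      apply Int.ediv_eq_of_eq_mul_right (by positivity)
      push_cast
      linear_combination (f : ℤ) * hm
    have hm'' : (n₂ : ℝ) * q = f * m := by exact_mod_cast hm
    have e1 : ∀ e : ℕ, expTwoPiI ((e : ℝ) * ((q : ℝ) * n₂) / ((f * r : ℕ) : ℝ)) =
        expTwoPiI ((e : ℝ) * m / r) := fun e => by
      congr 1
      have hf' : (f : ℝ) ≠ 0 := by positivity
      have hr' : (r : ℝ) ≠ 0 := by positivity
      rw [mul_comm (q : ℝ), hm'']
      push_cast
      field_simp
    simp only [e1, ← Finset.sum_mul, ← classicalRamanujanSum_eq, hm']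
    rw [classicalRamanujanSum_eq q n₁, Finset.mul_sum, Finset.sum_mul, Finset.sum_mul]
    refine Finset.sum_congr rfl fun b hb => ?_
    have hs := (bezoutPair_spec hq hf (mem_reducedResidues.1 hb).2).2
    -- The Bézout coefficient varies with `b`; being a unit mod `f`, it drops out, and the `b`-sum
    -- separates.
    rw [classicalRamanujanSum_mul_of_isCoprime hf hs.neg_left]
    ring
  · simp

theorem lemma6p3 (c₁ c₂ : ℕ) (hc₁ : 0 < c₁) (hc₂ : 0 < c₂) (n₁ n₂ : ℤ) :
    Finite (KloostermanDoubleCosets c₁ c₂) ∧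
      ramanujanSumSL3 c₁ c₂ n₁ n₂ =
        ∑ f ∈ (Nat.gcd c₁ c₂).divisors.filter (fun f : ℕ => (f : ℤ) ∣ n₂ * ((c₁ / f : ℕ) : ℤ)),
          (f : ℂ) * classicalRamanujanSum (c₁ / f) n₁ * classicalRamanujanSum f n₂ *
            classicalRamanujanSum (c₂ / f) ((c₁ : ℤ) * n₂ / (f : ℤ) ^ 2) := by
  refine ⟨finite_kloostermanDoubleCosets hc₁ hc₂, ?_⟩
  rw [ramanujanSumSL3_eq_sum hc₁ hc₂, doubleCosetParameters, Finset.sum_sigma, Finset.sum_filter]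
  exact Finset.sum_congr rfl fun f hf => sum_parameterTerm_fiber hc₁ hc₂ hf n₁ n₂
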